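/- Let $R$ be a commutative Noetherian ring and let $I$ be an ideal of $R$. For an ideal $J$ of $R$, let $$\widetilde{J}=\bigcup_{k\ge 1}(J^{k+1}:_R J^k)=\{x\in R : xJ^k\subseteq J^{k+1}\text{ for some }k\ge 1\}$$ denote the Ratliff–Rush closure of $J$, and write $\widetilde{I^n}$ for the Ratliff–Rush closure of the power $I^n$ (one has $\widetilde{I^{n+1}}\subseteq\widetilde{I^n}$). Then the sequences of sets of associated primes $$\operatorname{Ass}_R\bigl(R/\widetilde{I^n}\bigr)\quad\text{and}\quad \operatorname{Ass}_R\bigl(\widetilde{I^n}/\widetilde{I^{n+1}}\bigr),\qquad n=1,2,\dots,$$ are increasing and eventually constant. Moreover, for all large $n$, $$\operatorname{Ass}_R\bigl(R/\widetilde{I^n}\bigr)=\operatorname{Ass}_R\bigl(\widetilde{I^n}/\widetilde{I^{n+1}}\bigr).$$ -/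

import Mathlib

/-- The Ratliff-Rush closure of an ideal `I` of a commutative ring `R`: the union over `n ≥ 1` of
the ideals `(I ^ (n + 1) :_R I ^ n)`, i.e. the set of all `x` such that `x I ^ n ⊆ I ^ (n + 1)`
for some `n ≥ 1`. -/
def Ideal.ratliffRush {R : Type*} [CommRing R] (I : Ideal R) : Ideal R where
  carrier := {x : R | ∃ n : ℕ, 1 ≤ n ∧ ∀ a ∈ I ^ n, x * a ∈ I ^ (n + 1)}
  zero_mem' := ⟨1, le_rfl, fun a _ => by rw [zero_mul]; exact zero_mem _⟩
  smul_mem' := by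
    rintro c x ⟨n, hn, h⟩
    refine ⟨n, hn, fun a ha => ?_⟩
    rw [smul_eq_mul, mul_assoc]
    exact Ideal.mul_mem_left _ c (h a ha)
  add_mem' := by
    -- the colon ideals increase with the exponent
    have key : ∀ (x : R) (n k : ℕ), (∀ a ∈ I ^ n, x * a ∈ I ^ (n + 1)) →
        ∀ a ∈ I ^ (n + k), x * a ∈ I ^ (n + k + 1) := by
      intro x n k h a ha
      rw [pow_add] at ha
      rw [add_right_comm, pow_add]
      refine Submodule.mul_induction_on ha (fun b hb c hc => ?_) (fun b c hb hc => ?_)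
      · rw [← mul_assoc]
        exact Ideal.mul_mem_mul (h b hb) hc
      · rw [mul_add]
        exact add_mem hb hc
    rintro x y ⟨n, hn, hx⟩ ⟨m, hm, hy⟩
    refine ⟨n + m, by omega, fun a ha => ?_⟩
    rw [add_mul]
    refine add_mem (key x n m hx a ha) ?_
    rw [add_comm n m] at ha ⊢
    exact key y m n hy a ha

/-- The closures of the powers of an ideal decrease, so that the quotient of the closure of `I ^ n`
by the closure of `I ^ (n + 1)` makes sense. -/
theorem Ideal.ratliffRush_pow_succ_le {R : Type*} [CommRing R] (I : Ideal R) (n : ℕ) :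
    (I ^ (n + 1)).ratliffRush ≤ (I ^ n).ratliffRush := by
  rintro x ⟨k, hk, h⟩
  rcases n with _ | n
  · exact ⟨1, le_rfl, fun a _ => by rw [pow_zero, one_pow, Ideal.one_eq_top]; trivial⟩
  refine ⟨(n + 2) * k, by nlinarith, fun a ha => ?_⟩
  simp only [← pow_mul] at h ha ⊢
  have e : (n + 1) * ((n + 2) * k) = (n + 1 + 1) * k + n * ((n + 2) * k) := by ring
  rw [e, pow_add] at ha
  have le : I ^ ((n + 1 + 1) * (k + 1)) * I ^ (n * ((n + 2) * k)) ≤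
      I ^ ((n + 1) * ((n + 2) * k + 1)) := by
    rw [← pow_add]
    exact Ideal.pow_le_pow_right (by ring_nf; omega)
  apply le
  refine Submodule.mul_induction_on ha (fun b hb c hc => ?_) (fun b c hb hc => ?_)
  · rw [← mul_assoc x b c]
    exact Ideal.mul_mem_mul (h b hb) hc
  · rw [mul_add x b c]
    exact add_mem hb hc

/-- `Ass_R (R / J)`, where `J` is the Ratliff-Rush closure of `I ^ n`. -/
def Ideal.assRatliffRush {R : Type*} [CommRing R] (I : Ideal R) (n : ℕ) : Set (Ideal R) :=
  associatedPrimes R (R ⧸ (I ^ n).ratliffRush)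

/-- `Ass_R (J / J')`, where `J` and `J'` are the Ratliff-Rush closures of `I ^ n` and
`I ^ (n + 1)`; here `J' ⊆ J` is regarded as a submodule of `J`. -/
def Ideal.assRatliffRushGr {R : Type*} [CommRing R] (I : Ideal R) (n : ℕ) : Set (Ideal R) :=
  associatedPrimes R
    ((I ^ n).ratliffRush ⧸ Submodule.submoduleOf (I ^ (n + 1)).ratliffRush (I ^ n).ratliffRush)

namespace Ideal

open Submodule Polynomial

variable {R : Type*} [CommRing R]

/-! Write `J_n` for the closure of `I ^ n`: those `x` with `x I ^ m ⊆ I ^ (m + n)` for some `m`,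
equivalently for all large `m`. Hence `(J_{n+1} : I) = J_n`. A prime `(J_n : x)` is then the
intersection of the `(J_{n+1} : x a)` over finitely many generators `a` of `I`, so it equals one of
them; this makes both sequences increase. Moreover `Ass (R / J_{n+1}) = Ass (J_n / J_{n+1})` for
every `n ≥ 0`, so it remains to bound the second sequence. The same intersection argument with `I ^
m`, `m` large, turns a member into a prime `(I ^ (k + 1) : c)` with `c ∈ I ^ k`. Such primes are
contracted from associated primes of the associated graded ring, a quotient of the Noetherian Rees
algebra, and there are finitely many of these. -/

theorem mul_mem_pow_of_mul_mem_pow {I : Ideal R} {x : R} {m n : ℕ}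
    (h : ∀ a ∈ I ^ m, x * a ∈ I ^ (m + n)) {k : ℕ} (hk : m ≤ k) :
    ∀ a ∈ I ^ k, x * a ∈ I ^ (k + n) := by
  obtain ⟨j, rfl⟩ := Nat.exists_eq_add_of_le hk
  intro a ha
  rw [pow_add] at ha
  rw [add_right_comm, pow_add]
  refine Submodule.mul_induction_on ha (fun b hb c hc => ?_) (fun b c hb hc => ?_)
  · rw [← mul_assoc]
    exact Ideal.mul_mem_mul (h b hb) hc
  · rw [mul_add]
    exact add_mem hb hc

theorem mem_ratliffRush_pow {I : Ideal R} {x : R} {n : ℕ} :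
    x ∈ (I ^ n).ratliffRush ↔ ∃ m, ∀ a ∈ I ^ m, x * a ∈ I ^ (m + n) := by
  constructor
  · rintro ⟨k, -, h⟩
    refine ⟨n * k, fun a ha => ?_⟩
    have := h a (by rwa [← pow_mul])
    rwa [← pow_mul, mul_add, mul_one] at this
  · rintro ⟨m, h⟩
    -- The definition asks for an exponent at least 1. For `n ≥ 1`, `(I ^ n) ^ (m + 1)` lies in `I ^
    -- m`; for `n = 0` it need not, but the target is then all of `R`.
    refine ⟨m + 1, by omega, fun a ha => ?_⟩
    rcases Nat.eq_zero_or_pos n with rfl | hn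
    · rw [pow_zero, Ideal.one_eq_top, Ideal.top_pow]
      exact mem_top
    · rw [← pow_mul] at ha ⊢
      rw [mul_add_one]
      exact mul_mem_pow_of_mul_mem_pow h (by nlinarith) a ha

/-- For Noetherian `R`, a single exponent computes the Ratliff-Rush closure of `I ^ n`. -/
theorem exists_forall_mem_ratliffRush_pow_iff [IsNoetherianRing R] (I : Ideal R) (n : ℕ) :
    ∃ N, ∀ m, N ≤ m → ∀ x, x ∈ (I ^ n).ratliffRush ↔ ∀ a ∈ I ^ m, x * a ∈ I ^ (m + n) := by
  let C : ℕ →o Ideal R :=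
    { toFun := fun m => (I ^ (m + n)).colon (I ^ m : Ideal R)
      monotone' := fun i j hij x hx => by
        simp only [Submodule.mem_colon, SetLike.mem_coe, smul_eq_mul] at hx ⊢
        exact mul_mem_pow_of_mul_mem_pow hx hij }
  have hC (m : ℕ) (x : R) : x ∈ C m ↔ ∀ a ∈ I ^ m, x * a ∈ I ^ (m + n) := Submodule.mem_colon
  obtain ⟨N, hN⟩ := monotone_stabilizes_iff_noetherian.mpr ‹IsNoetherianRing R› C
  refine ⟨N, fun m hm x => ⟨fun hx => ?_, fun h => mem_ratliffRush_pow.mpr ⟨m, h⟩⟩⟩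
  obtain ⟨k, hk⟩ := mem_ratliffRush_pow.mp hx
  rw [← hC] at hk ⊢
  rw [← hN m hm, hN (max k N) (le_max_right _ _)]
  exact C.monotone (le_max_left _ _) hk

theorem mul_mem_ratliffRush_pow_succ {I : Ideal R} {n : ℕ} {x a : R}
    (hx : x ∈ (I ^ n).ratliffRush) (ha : a ∈ I) : x * a ∈ (I ^ (n + 1)).ratliffRush := by
  obtain ⟨m, h⟩ := mem_ratliffRush_pow.mp hx
  refine mem_ratliffRush_pow.mpr ⟨m, fun b hb => ?_⟩
  rw [← add_assoc, pow_succ, mul_right_comm]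
  exact Ideal.mul_mem_mul (h b hb) ha

/-- The colon of the closure of `I ^ (n + 1)` by `I` is the closure of `I ^ n`. -/
theorem mem_ratliffRush_pow_iff_forall_mul_mem [IsNoetherianRing R] {I : Ideal R} {n : ℕ} {x : R} :
    x ∈ (I ^ n).ratliffRush ↔ ∀ a ∈ I, x * a ∈ (I ^ (n + 1)).ratliffRush := by
  refine ⟨fun hx a ha => mul_mem_ratliffRush_pow_succ hx ha, fun h => ?_⟩
  obtain ⟨m, hm⟩ := exists_forall_mem_ratliffRush_pow_iff I (n + 1)
  refine mem_ratliffRush_pow.mpr ⟨m + 1, fun b hb => ?_⟩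
  rw [pow_succ'] at hb
  refine Submodule.mul_induction_on hb (fun a ha c hc => ?_) (fun b c hb hc => ?_)
  · rw [← mul_assoc, show m + 1 + n = m + (n + 1) by ring]
    exact (hm m le_rfl _).mp (h a ha) c hc
  · rw [mul_add]
    exact add_mem hb hc

/-- If a prime is the colon `(J : x K)` with `K` finitely generated, then it is already of the
form `(J : x a)` with `a ∈ K`. -/
theorem IsPrime.exists_mem_iff_mul_mul_mem {P J K : Ideal R} (hP : P.IsPrime) (hK : K.FG) {x : R}
    (h : ∀ r, r ∈ P ↔ ∀ a ∈ K, r * x * a ∈ J) : ∃ a ∈ K, ∀ r, r ∈ P ↔ r * (x * a) ∈ J := by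
  obtain ⟨s, rfl⟩ := hK
  have hcolon (r a : R) : r ∈ J.colon {x * a} ↔ r * x * a ∈ J := by
    rw [Submodule.mem_colon_singleton, smul_eq_mul, mul_assoc]
  have hinf : s.inf (fun a => J.colon {x * a}) ≤ P := fun r hr => by
    rw [Submodule.mem_finsetInf] at hr
    refine (h r).mpr fun a ha => ?_
    rw [← hcolon, Submodule.mem_colon_singleton]
    refine Submodule.span_induction (p := fun a _ => r • (x * a) ∈ J) ?_ ?_ ?_ ?_ ha
    · exact fun a ha => Submodule.mem_colon_singleton.mp (hr a ha)
    · simp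
    · intro a b _ _ ha hb
      rw [mul_add, smul_add]
      exact add_mem ha hb
    · intro c a _ ha
      rw [mul_smul_comm, smul_comm]
      exact J.smul_mem c ha
  -- A prime containing a finite intersection of ideals contains one of them.
  obtain ⟨a, ha, hle⟩ := hP.inf_le'.mp hinf
  refine ⟨a, subset_span ha, fun r => ⟨fun hr => ?_, fun hr => hle ?_⟩⟩
  · rw [← mul_assoc]
    exact (h r).mp hr a (subset_span ha)
  · rwa [hcolon, mul_assoc]

/-- The ideal `⨁ I ^ (i + 1) t ^ i` of the Rees algebra `⨁ I ^ i t ^ i`, which is the kernel of the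
map onto the associated graded ring. -/
def reesShift (I : Ideal R) : Ideal (reesAlgebra I) where
  carrier := {f | ∀ i, (f : R[X]).coeff i ∈ I ^ (i + 1)}
  zero_mem' i := by simp
  add_mem' hf hg i := by
    simpa using add_mem (hf i) (hg i)
  smul_mem' f g hg i := by
    rw [smul_eq_mul, Subalgebra.coe_mul, coeff_mul]
    refine Ideal.sum_mem _ fun p hp => ?_
    rw [← Finset.HasAntidiagonal.mem_antidiagonal.mp hp, add_assoc, pow_add]
    exact Ideal.mul_mem_mul (f.2 p.1) (hg p.2)

theorem monomial_mem_reesShift {I : Ideal R} {k : ℕ} {c : R}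
    (hc : monomial k c ∈ reesAlgebra I) :
    (⟨monomial k c, hc⟩ : reesAlgebra I) ∈ reesShift I ↔ c ∈ I ^ (k + 1) := by
  refine ⟨fun h => by simpa using h k, fun h i => ?_⟩
  rw [coeff_monomial]
  split_ifs with hi
  · exact hi ▸ h
  · exact zero_mem _

variable [IsNoetherianRing R]

theorem finite_associatedPrimes_quotient (J : Ideal R) :
    (associatedPrimes R (R ⧸ J)).Finite :=
  associatedPrimes.finite R (R ⧸ J)

theorem mem_associatedPrimes_quotient_iff {J P : Ideal R} :
    P ∈ associatedPrimes R (R ⧸ J) ↔ P.IsPrime ∧ ∃ x, ∀ r, r ∈ P ↔ r * x ∈ J := by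
  rw [AssociatedPrimes.mem_iff, isAssociatedPrime_iff]
  refine and_congr_right fun _ => (Ideal.Quotient.mk_surjective.exists).trans
    (exists_congr fun x => ?_)
  rw [SetLike.ext_iff]
  refine forall_congr' fun r => ?_
  rw [Submodule.mem_colon_singleton, Submodule.mem_bot, ← Ideal.Quotient.eq_zero_iff_mem (I := J)]
  rfl

theorem mem_assRatliffRush {I P : Ideal R} {n : ℕ} :
    P ∈ I.assRatliffRush n ↔ P.IsPrime ∧ ∃ x, ∀ r, r ∈ P ↔ r * x ∈ (I ^ n).ratliffRush :=
  mem_associatedPrimes_quotient_iff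

theorem mem_assRatliffRushGr {I P : Ideal R} {n : ℕ} :
    P ∈ I.assRatliffRushGr n ↔ P.IsPrime ∧ ∃ x ∈ (I ^ n).ratliffRush,
      ∀ r, r ∈ P ↔ r * x ∈ (I ^ (n + 1)).ratliffRush := by
  rw [assRatliffRushGr, AssociatedPrimes.mem_iff, isAssociatedPrime_iff]
  have key (x : (I ^ n).ratliffRush) (r : R) :
      r ∈ (⊥ : Submodule R ((I ^ n).ratliffRush ⧸
        submoduleOf (I ^ (n + 1)).ratliffRush (I ^ n).ratliffRush)).colon {Submodule.mkQ _ x} ↔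
        r * x ∈ (I ^ (n + 1)).ratliffRush := by
    rw [Submodule.mem_colon_singleton, Submodule.mem_bot, ← map_smul, Submodule.mkQ_apply,
      Submodule.Quotient.mk_eq_zero]
    rfl
  refine and_congr_right fun _ => ⟨?_, ?_⟩
  · rintro ⟨y, rfl⟩
    obtain ⟨x, rfl⟩ := Submodule.mkQ_surjective _ y
    exact ⟨x, x.2, key x⟩
  · rintro ⟨x, hx, h⟩
    exact ⟨_, Submodule.ext fun r => (h r).trans (key ⟨x, hx⟩ r).symm⟩

theorem assRatliffRush_subset_succ (I : Ideal R) (n : ℕ) :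
    I.assRatliffRush n ⊆ I.assRatliffRush (n + 1) := by
  intro P hP
  obtain ⟨hP, x, hx⟩ := mem_assRatliffRush.mp hP
  obtain ⟨a, -, h⟩ := hP.exists_mem_iff_mul_mul_mem (IsNoetherian.noetherian I)
    fun r => (hx r).trans mem_ratliffRush_pow_iff_forall_mul_mem
  exact mem_assRatliffRush.mpr ⟨hP, _, h⟩

theorem assRatliffRushGr_subset_succ (I : Ideal R) (n : ℕ) :
    I.assRatliffRushGr n ⊆ I.assRatliffRushGr (n + 1) := by
  intro P hP
  obtain ⟨hP, x, hxn, hx⟩ := mem_assRatliffRushGr.mp hP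
  obtain ⟨a, ha, h⟩ := hP.exists_mem_iff_mul_mul_mem (IsNoetherian.noetherian I)
    fun r => (hx r).trans mem_ratliffRush_pow_iff_forall_mul_mem
  exact mem_assRatliffRushGr.mpr ⟨hP, _, mul_mem_ratliffRush_pow_succ hxn ha, h⟩

theorem assRatliffRushGr_subset_assRatliffRush (I : Ideal R) (n : ℕ) :
    I.assRatliffRushGr n ⊆ I.assRatliffRush (n + 1) := by
  intro P hP
  obtain ⟨hP, x, -, hx⟩ := mem_assRatliffRushGr.mp hP
  exact mem_assRatliffRush.mpr ⟨hP, x, hx⟩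

/-- Let `P = (J_{n+2} : x)`. If some `s ∉ P` has `s x ∈ J_{n+1}`, then `s x` also has colon `P`, as
`P` is prime. Otherwise `(J_{n+1} : x) ⊆ P`, with equality since `J_{n+2} ⊆ J_{n+1}`, and induction
applies to the same `x`. The base case is `J_0 = R`. -/
theorem assRatliffRush_subset_assRatliffRushGr (I : Ideal R) (n : ℕ) :
    I.assRatliffRush (n + 1) ⊆ I.assRatliffRushGr n := by
  intro P hPn
  obtain ⟨hP, x, hx⟩ := mem_assRatliffRush.mp hPn
  clear hPn
  induction n generalizing x with
  | zero =>
    refine mem_assRatliffRushGr.mpr ⟨hP, x, mem_ratliffRush_pow.mpr ⟨0, by simp⟩, hx⟩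
  | succ n ih =>
    by_cases hxP : ∃ s, s ∉ P ∧ s * x ∈ (I ^ (n + 1)).ratliffRush
    · obtain ⟨s, hs, hsx⟩ := hxP
      refine mem_assRatliffRushGr.mpr ⟨hP, s * x, hsx, fun r => ?_⟩
      rw [← mul_assoc, ← hx, hP.mul_mem_iff_mem_or_mem, or_iff_left hs]
    · push Not at hxP
      refine assRatliffRushGr_subset_succ I n (ih x fun r => ⟨fun hr => ?_, fun hr => ?_⟩)
      · exact ratliffRush_pow_succ_le I _ ((hx r).mp hr)
      · exact not_not.mp fun h => hxP r h hr

/-- A prime `(I ^ (k + 1) : c)` with `c ∈ I ^ k` is contracted from an associated prime of the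
associated graded ring. -/
theorem mem_image_comap_associatedPrimes_reesShift {I P : Ideal R} (hP : P.IsPrime) {k : ℕ} {c : R}
    (hc : c ∈ I ^ k) (h : ∀ r, r ∈ P ↔ r * c ∈ I ^ (k + 1)) :
    P ∈ comap (algebraMap R (reesAlgebra I)) ''
      associatedPrimes (reesAlgebra I) (reesAlgebra I ⧸ reesShift I) := by
  let f : reesAlgebra I := ⟨monomial k c, reesAlgebra.monomial_mem.mpr hc⟩
  have hcomap : comap (algebraMap R (reesAlgebra I)) ((reesShift I).colon {f}) = P := by
    ext r
    rw [h, mem_comap, Submodule.mem_colon_singleton, smul_eq_mul, ← Algebra.smul_def]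
    have hf : r • f = ⟨monomial k (r * c), reesAlgebra.monomial_mem.mpr (mul_mem_left _ r hc)⟩ :=
      Subtype.ext (by simp [f, smul_monomial])
    rw [hf, monomial_mem_reesShift]
  -- The colon of `f` need not be prime, but it contracts to `P`, so some prime `Q` minimal over it
  -- does too. Being minimal over the colon of an element in a Noetherian ring, `Q` is associated.
  obtain ⟨Q, hQ, rfl⟩ := exists_minimalPrimes_comap_eq (algebraMap R (reesAlgebra I)) P
    (I := (reesShift I).colon {f})
    (by rw [hcomap, minimalPrimes_eq_subsingleton_self]; rfl)
  obtain ⟨g, hg⟩ := exists_eq_colon_of_mem_minimalPrimes hQ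
  refine ⟨Q, mem_associatedPrimes_quotient_iff.mpr ⟨hQ.1.1, g, fun r => ?_⟩, rfl⟩
  rw [hg, Submodule.mem_colon_singleton, smul_eq_mul]

theorem finite_iUnion_assRatliffRushGr (I : Ideal R) : (⋃ n, I.assRatliffRushGr n).Finite := by
  refine ((finite_associatedPrimes_quotient (reesShift I)).image
    (comap (algebraMap R (reesAlgebra I)))).subset (Set.iUnion_subset fun n P hP => ?_)
  obtain ⟨hP, x, hxn, hx⟩ := mem_assRatliffRushGr.mp hP
  obtain ⟨m₁, h₁⟩ := mem_ratliffRush_pow.mp hxn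
  obtain ⟨m₂, h₂⟩ := exists_forall_mem_ratliffRush_pow_iff I (n + 1)
  -- With `m = m₁ + m₂`, multiplication by `x` sends `I ^ m` into `I ^ (m + n)`, and `I ^ m` also
  -- tests membership in the closure of `I ^ (n + 1)`.
  obtain ⟨a, ha, h⟩ := hP.exists_mem_iff_mul_mul_mem (IsNoetherian.noetherian (I ^ (m₁ + m₂)))
    fun r => (hx r).trans (h₂ (m₁ + m₂) (by omega) _)
  exact mem_image_comap_associatedPrimes_reesShift hP
    (mul_mem_pow_of_mul_mem_pow h₁ (by omega) a ha) h

end Ideal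

theorem Monotone.exists_forall_eq_of_finite_iUnion {α : Type*} {f : ℕ → Set α} (hf : Monotone f)
    (hfin : (⋃ n, f n).Finite) : ∃ N, ∀ n, N ≤ n → f n = f N := by
  obtain ⟨N, hN⟩ := hf.directed_le.exists_mem_subset_of_finset_subset_biUnion
    (s := hfin.toFinset) (by simp)
  rw [hfin.coe_toFinset] at hN
  exact ⟨N, fun n hn => ((Set.subset_iUnion f n).trans hN).antisymm (hf hn)⟩

theorem corollary2p5 {R : Type*} [CommRing R] [IsNoetherianRing R] (I : Ideal R) :
    (∀ n : ℕ, 1 ≤ n → I.assRatliffRush n ⊆ I.assRatliffRush (n + 1)) ∧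
    (∃ N : ℕ, 1 ≤ N ∧ ∀ n : ℕ, N ≤ n → I.assRatliffRush n = I.assRatliffRush N) ∧
    (∀ n : ℕ, 1 ≤ n → I.assRatliffRushGr n ⊆ I.assRatliffRushGr (n + 1)) ∧
    (∃ N : ℕ, 1 ≤ N ∧ ∀ n : ℕ, N ≤ n → I.assRatliffRushGr n = I.assRatliffRushGr N) ∧
    (∃ N : ℕ, 1 ≤ N ∧ ∀ n : ℕ, N ≤ n → I.assRatliffRush n = I.assRatliffRushGr n) := by
  obtain ⟨N, hN⟩ := (monotone_nat_of_le_succ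
    I.assRatliffRushGr_subset_succ).exists_forall_eq_of_finite_iUnion
    I.finite_iUnion_assRatliffRushGr
  have hsucc (n : ℕ) : I.assRatliffRush (n + 1) = I.assRatliffRushGr n :=
    (I.assRatliffRush_subset_assRatliffRushGr n).antisymm
      (I.assRatliffRushGr_subset_assRatliffRush n)
  -- The index shift in `hsucc` delays stability by one step.
  have heq (n : ℕ) (hn : N + 1 ≤ n) : I.assRatliffRush n = I.assRatliffRushGr N := by
    obtain ⟨k, rfl⟩ := Nat.exists_eq_add_of_le' (Nat.one_le_of_lt hn)
    rw [hsucc, hN k (by omega)]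
  refine ⟨fun n _ => I.assRatliffRush_subset_succ n,
    ⟨N + 1, by omega, fun n hn => by rw [heq n hn, heq _ le_rfl]⟩,
    fun n _ => I.assRatliffRushGr_subset_succ n,
    ⟨N + 1, by omega, fun n hn => by rw [hN n (by omega), hN (N + 1) (by omega)]⟩,
    ⟨N + 1, by omega, fun n hn => by rw [heq n hn, hN n (by omega)]⟩⟩
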